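/- Let $k$ be an algebraically closed field of characteristic zero. For $N\ge 1$ let $\mathcal A_s(N)$ be the Hopf algebra over $k$ with algebra generators $u_{ij}$ ($1\le i,j\le N$), relations $$u_{ij}u_{il}=\delta_{jl}u_{ij},\qquad u_{ij}u_{lj}=\delta_{il}u_{ij},\qquad \sum_{l}u_{il}=1=\sum_l u_{li},$$ and structure maps $\Delta(u_{ij})=\sum_l u_{il}\otimes u_{lj}$, $\epsilon(u_{ij})=\delta_{ij}$, $S(u_{ij})=u_{ji}$. A Hopf algebra $H$ over $k$ is called a quantum permutation algebra if there is a surjective Hopf algebra map $\mathcal A_s(N)\to H$ for some $N$. For $n\ge 2$ let $\Gamma=C_n=\langle (1\,2\cdots n)\rangle\subset\mathbb S_n$ and $F=\{x\in\mathbb S_n: x(n)=n\}\simeq\mathbb S_{n-1}$, so that $\mathbb S_n=F\Gamma$ is an exact factorization. Define $g\triangleright x\in F$ and $g\triangleleft x\in\Gamma$, for $g\in\Gamma$ and $x\in F$, by $gx=(g\triangleright x)(g\triangleleft x)$. The split abelian extension $k^{C_n}\#k\mathbb S_{n-1}$ is the Hopf algebra with basis $e_g\# x$ ($g\in\Gamma$,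 $x\in F$) and $$(e_g\# x)(e_h\# y)=\delta_{g\triangleleft x,\,h}\;e_g\# xy,\qquad \Delta(e_g\# x)=\sum_{st=g}\big(e_s\#(t\triangleright x)\big)\otimes (e_t\# x),$$ with unit $\sum_{g}e_g\# 1$ and counit $\epsilon(e_g\# x)=\delta_{g,1}$. **Theorem.** The Hopf algebras $k^{C_4}\# k\mathbb S_3$ and $k^{C_5}\# k\mathbb S_4$, of dimensions $24$ and $120$ respectively, are cosemisimple (each is the sum of its simple subcoalgebras), and neither of them is a quantum permutation algebra. In particular, there exist finite-dimensional cosemisimple Hopf algebras over $k$ which are not quantum permutation algebras. -/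

import Mathlib

open scoped TensorProduct

universe u

/-! ### Cosemisimple coalgebras -/

section Cosemisimple

variable (k : Type*) {C : Type*} [CommSemiring k] [AddCommMonoid C] [Module k C] [Coalgebra k C]

/-- A subspace `D` of a coalgebra is a subcoalgebra if `Δ(D) ⊆ D ⊗ D`. -/
def IsSubcoalgebra (D : Submodule k C) : Prop :=
  ∀ d ∈ D, Coalgebra.comul (R := k) d ∈
    LinearMap.range (TensorProduct.map D.subtype D.subtype)

/-- A simple subcoalgebra: nonzero, with no subcoalgebras besides `0` and itself. -/
def IsSimpleSubcoalgebra (D : Submodule k C) : Prop :=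
  IsSubcoalgebra k D ∧ D ≠ ⊥ ∧ ∀ E : Submodule k C, IsSubcoalgebra k E → E ≤ D → E = ⊥ ∨ E = D

variable (C) in
/-- A coalgebra is cosemisimple if it is the sum of its simple subcoalgebras, that is, if it
equals its coradical. -/
def IsCosemisimple : Prop :=
  sSup {D : Submodule k C | IsSimpleSubcoalgebra k D} = ⊤

end Cosemisimple

/-! ### The Hopf algebra of the quantum permutation group -/

section Wang

variable (k : Type u) [Field k] (n : ℕ)

/-- The relations making the matrix of generators `u i j` a magic matrix. -/
inductive MagicRel :
    FreeAlgebra k (Fin n × Fin n) → FreeAlgebra k (Fin n × Fin n) → Prop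
  | row_mul (i j l : Fin n) :
      MagicRel (FreeAlgebra.ι k (i, j) * FreeAlgebra.ι k (i, l))
        (if j = l then FreeAlgebra.ι k (i, j) else 0)
  | col_mul (i j l : Fin n) :
      MagicRel (FreeAlgebra.ι k (i, j) * FreeAlgebra.ι k (l, j))
        (if i = l then FreeAlgebra.ι k (i, j) else 0)
  | row_sum (i : Fin n) : MagicRel (∑ l, FreeAlgebra.ι k (i, l)) 1
  | col_sum (i : Fin n) : MagicRel (∑ l, FreeAlgebra.ι k (l, i)) 1

/-- The algebra `A_s(n)`: generators `u i j` (`1 ≤ i, j ≤ n`) subject to the magic relations. -/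
def QuantumPerm : Type u := RingQuot (MagicRel k n)

namespace QuantumPerm

noncomputable instance : Ring (QuantumPerm k n) := inferInstanceAs (Ring (RingQuot (MagicRel k n)))

noncomputable instance : Algebra k (QuantumPerm k n) :=
  inferInstanceAs (Algebra k (RingQuot (MagicRel k n)))

variable {n}

/-- The generator `u i j`. -/
noncomputable def u (i j : Fin n) : QuantumPerm k n :=
  RingQuot.mkAlgHom k (MagicRel k n) (FreeAlgebra.ι k (i, j))

theorem u_row_mul (i j l : Fin n) : u k i j * u k i l = if j = l then u k i j else 0 := by
  have h := RingQuot.mkAlgHom_rel k (MagicRel.row_mul (k := k) i j l)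
  rw [map_mul] at h
  refine h.trans ?_
  split_ifs
  · rfl
  · exact map_zero _

theorem u_col_mul (i j l : Fin n) : u k i j * u k l j = if i = l then u k i j else 0 := by
  have h := RingQuot.mkAlgHom_rel k (MagicRel.col_mul (k := k) i j l)
  rw [map_mul] at h
  refine h.trans ?_
  split_ifs
  · rfl
  · exact map_zero _

theorem u_row_sum (i : Fin n) : ∑ l, u k i l = 1 := by
  have h := RingQuot.mkAlgHom_rel k (MagicRel.row_sum (k := k) i)
  rw [map_sum, map_one] at h
  exact h

theorem u_col_sum (i : Fin n) : ∑ l, u k l i = 1 := by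
  have h := RingQuot.mkAlgHom_rel k (MagicRel.col_sum (k := k) i)
  rw [map_sum, map_one] at h
  exact h

section Lift

variable {k} {B : Type*} [Ring B] [Algebra k B]

/-- The universal property: a magic matrix in `B` gives an algebra map from `A_s(n)`. -/
noncomputable def lift (x : Fin n → Fin n → B)
    (h1 : ∀ i j l, x i j * x i l = if j = l then x i j else 0)
    (h2 : ∀ i j l, x i j * x l j = if i = l then x i j else 0)
    (h3 : ∀ i, ∑ l, x i l = 1) (h4 : ∀ i, ∑ l, x l i = 1) : QuantumPerm k n →ₐ[k] B :=
  RingQuot.liftAlgHom k ⟨FreeAlgebra.lift k fun p : Fin n × Fin n => x p.1 p.2, by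
    intro a b hab
    induction hab with
    | row_mul i j l => rw [map_mul]; simp only [FreeAlgebra.lift_ι_apply, h1]; split_ifs <;> simp
    | col_mul i j l => rw [map_mul]; simp only [FreeAlgebra.lift_ι_apply, h2]; split_ifs <;> simp
    | row_sum i => simp [h3]
    | col_sum i => simp [h4]⟩

@[simp] theorem lift_u (x : Fin n → Fin n → B) (h1 h2 h3 h4) (i j : Fin n) :
    lift (k := k) x h1 h2 h3 h4 (u k i j) = x i j := by
  refine (RingQuot.liftAlgHom_mkAlgHom_apply k _ _ _).trans ?_
  exact FreeAlgebra.lift_ι_apply _ _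

@[ext] theorem algHom_ext {f g : QuantumPerm k n →ₐ[k] B}
    (h : ∀ i j, f (u k i j) = g (u k i j)) : f = g := by
  refine RingQuot.ringQuot_ext' k f g ?_
  refine FreeAlgebra.hom_ext ?_
  funext p
  exact h p.1 p.2

end Lift

/-- The generators `u i j` generate `A_s(n)`. -/
theorem adjoin_u : Algebra.adjoin k {a | ∃ i j, a = u k (n := n) i j} = ⊤ := by
  set S := Algebra.adjoin k {a | ∃ i j, a = u k (n := n) i j} with hS
  have hu : ∀ i j, u k (n := n) i j ∈ S := fun i j => Algebra.subset_adjoin ⟨i, j, rfl⟩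
  let f : QuantumPerm k n →ₐ[k] S := lift (fun i j => ⟨u k i j, hu i j⟩)
    (fun i j l => Subtype.ext (by
      have := u_row_mul k i j l
      split_ifs at this ⊢ <;> simpa using this))
    (fun i j l => Subtype.ext (by
      have := u_col_mul k i j l
      split_ifs at this ⊢ <;> simpa using this))
    (fun i => Subtype.ext (by simpa using u_row_sum k i))
    (fun i => Subtype.ext (by simpa using u_col_sum k i))
  have hf : S.val.comp f = AlgHom.id k _ := by
    ext i j
    simp [f]
  refine eq_top_iff.2 fun a _ => ?_
  have := DFunLike.congr_fun hf a
  simp only [AlgHom.comp_apply, AlgHom.id_apply, Subalgebra.coe_val] at this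
  rw [← this]
  exact (f a).2

/-- The comultiplication `Δ(u i j) = ∑ l, u i l ⊗ u l j`. -/
noncomputable def comulHom : QuantumPerm k n →ₐ[k] QuantumPerm k n ⊗[k] QuantumPerm k n :=
  lift (fun i j => ∑ l, u k i l ⊗ₜ[k] u k l j)
    (fun i j m => by
      simp only [Finset.sum_mul_sum, Algebra.TensorProduct.tmul_mul_tmul, u_row_mul]
      simp only [TensorProduct.ite_tmul, Finset.sum_ite_eq, Finset.mem_univ, if_true, u_row_mul]
      split_ifs <;> simp)
    (fun i j m => by
      simp only [Finset.sum_mul_sum, Algebra.TensorProduct.tmul_mul_tmul, u_col_mul]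
      simp only [TensorProduct.tmul_ite, Finset.sum_ite_eq, Finset.mem_univ, if_true, u_col_mul]
      split_ifs <;> simp)
    (fun i => by
      rw [Finset.sum_comm]
      simp only [← TensorProduct.tmul_sum, u_row_sum, ← TensorProduct.sum_tmul]
      rfl)
    (fun i => by
      rw [Finset.sum_comm]
      simp only [← TensorProduct.sum_tmul, u_col_sum, ← TensorProduct.tmul_sum]
      rfl)

@[simp] theorem comulHom_u (i j : Fin n) :
    comulHom k (u k i j) = ∑ l, u k i l ⊗ₜ[k] u k l j := lift_u _ _ _ _ _ _ _

/-- The counit `ε(u i j) = δ i j`. -/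
noncomputable def counitHom : QuantumPerm k n →ₐ[k] k :=
  lift (fun i j => if i = j then 1 else 0)
    (fun i j l => by split_ifs <;> simp_all)
    (fun i j l => by split_ifs <;> simp_all)
    (fun i => by simp) (fun i => by simp)

@[simp] theorem counitHom_u (i j : Fin n) :
    counitHom k (u k i j) = if i = j then 1 else 0 := lift_u _ _ _ _ _ _ _

/-- The antipode `S(u i j) = u j i`, an algebra map to the opposite algebra. -/
noncomputable def antipodeHom : QuantumPerm k n →ₐ[k] (QuantumPerm k n)ᵐᵒᵖ :=
  lift (fun i j => MulOpposite.op (u k j i))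
    (fun i j l => by
      rw [← MulOpposite.op_mul, u_col_mul]
      split_ifs with h h' h' <;> simp_all)
    (fun i j l => by
      rw [← MulOpposite.op_mul, u_row_mul]
      split_ifs with h h' h' <;> simp_all)
    (fun i => by rw [← Finset.op_sum, u_col_sum]; rfl)
    (fun i => by rw [← Finset.op_sum, u_row_sum]; rfl)

@[simp] theorem antipodeHom_u (i j : Fin n) :
    antipodeHom k (u k i j) = MulOpposite.op (u k j i) := lift_u _ _ _ _ _ _ _

noncomputable instance : Bialgebra k (QuantumPerm k n) :=
  Bialgebra.ofAlgHom (comulHom k) (counitHom k)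
    (by
      ext i j
      simp [TensorProduct.sum_tmul, TensorProduct.tmul_sum]
      exact Finset.sum_comm)
    (by ext i j; simp [TensorProduct.ite_tmul])
    (by ext i j; simp [TensorProduct.tmul_ite])

theorem comul_u (i j : Fin n) :
    Coalgebra.comul (R := k) (u k i j) = ∑ l, u k i l ⊗ₜ[k] u k l j := comulHom_u k i j

theorem counit_u (i j : Fin n) :
    Coalgebra.counit (R := k) (u k i j) = if i = j then 1 else 0 := counitHom_u k i j

/-- The antipode as a linear endomorphism. -/
noncomputable def antipodeLin : QuantumPerm k n →ₗ[k] QuantumPerm k n :=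
  (MulOpposite.opLinearEquiv k).symm.toLinearMap ∘ₗ (antipodeHom k).toLinearMap

@[simp] theorem antipodeLin_u (i j : Fin n) : antipodeLin k (u k i j) = u k j i := by
  simp [antipodeLin]

theorem antipodeLin_one : antipodeLin k (1 : QuantumPerm k n) = 1 := by
  simp [antipodeLin]

theorem antipodeLin_mul (a b : QuantumPerm k n) :
    antipodeLin k (a * b) = antipodeLin k b * antipodeLin k a := by
  simp [antipodeLin]

theorem antipode_left (a : QuantumPerm k n) :
    LinearMap.mul' k _ ((antipodeLin k).rTensor _ (Coalgebra.comul (R := k) a)) =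
      algebraMap k _ (Coalgebra.counit (R := k) a) := by
  have ha : a ∈ Algebra.adjoin k {a | ∃ i j, a = u k (n := n) i j} := by rw [adjoin_u]; trivial
  induction ha using Algebra.adjoin_induction with
  | mem x hx =>
    obtain ⟨i, j, rfl⟩ := hx
    simp only [comul_u, counit_u, map_sum, LinearMap.rTensor_tmul, antipodeLin_u,
      LinearMap.mul'_apply, u_row_mul]
    split_ifs with h
    · subst h; simp [u_col_sum]
    · simp
  | algebraMap r =>
    simp [Algebra.algebraMap_eq_smul_one, Algebra.TensorProduct.one_def, antipodeLin_one]
  | add x y _ _ hx hy => simp only [map_add, hx, hy]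
  | mul x y _ _ hx hy =>
    have key : ∀ s t : QuantumPerm k n ⊗[k] QuantumPerm k n,
        LinearMap.mul' k _ ((antipodeLin k).rTensor _ s) = algebraMap k _ (Coalgebra.counit x) →
        LinearMap.mul' k _ ((antipodeLin k).rTensor _ (s * t)) =
          Coalgebra.counit (R := k) x • LinearMap.mul' k _ ((antipodeLin k).rTensor _ t) := by
      intro s t hs
      induction t using TensorProduct.induction_on with
      | zero => simp
      | add t₁ t₂ h₁ h₂ => rw [mul_add, map_add, map_add, h₁, h₂, map_add, map_add, smul_add]
      | tmul c d =>
        have : LinearMap.mul' k _ ((antipodeLin k).rTensor _ (s * c ⊗ₜ[k] d)) =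
            antipodeLin k c * LinearMap.mul' k _ ((antipodeLin k).rTensor _ s) * d := by
          clear hs
          induction s using TensorProduct.induction_on with
          | zero => simp
          | add s₁ s₂ h₁ h₂ =>
            rw [add_mul, map_add, map_add, h₁, h₂, map_add, map_add, mul_add, add_mul]
          | tmul a b => simp [antipodeLin_mul, mul_assoc]
        rw [this, hs]
        simp [Algebra.algebraMap_eq_smul_one]
    rw [Bialgebra.comul_mul, key _ _ hx, hy, Bialgebra.counit_mul, map_mul, Algebra.smul_def]

theorem antipode_right (a : QuantumPerm k n) :
    LinearMap.mul' k _ ((antipodeLin k).lTensor _ (Coalgebra.comul (R := k) a)) =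
      algebraMap k _ (Coalgebra.counit (R := k) a) := by
  have ha : a ∈ Algebra.adjoin k {a | ∃ i j, a = u k (n := n) i j} := by rw [adjoin_u]; trivial
  induction ha using Algebra.adjoin_induction with
  | mem x hx =>
    obtain ⟨i, j, rfl⟩ := hx
    simp only [comul_u, counit_u, map_sum, LinearMap.lTensor_tmul, antipodeLin_u,
      LinearMap.mul'_apply, u_col_mul]
    split_ifs with h
    · subst h; simp [u_row_sum]
    · simp
  | algebraMap r =>
    simp [Algebra.algebraMap_eq_smul_one, Algebra.TensorProduct.one_def, antipodeLin_one]
  | add x y _ _ hx hy => simp only [map_add, hx, hy]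
  | mul x y _ _ hx hy =>
    have key : ∀ s t : QuantumPerm k n ⊗[k] QuantumPerm k n,
        LinearMap.mul' k _ ((antipodeLin k).lTensor _ t) = algebraMap k _ (Coalgebra.counit y) →
        LinearMap.mul' k _ ((antipodeLin k).lTensor _ (s * t)) =
          Coalgebra.counit (R := k) y • LinearMap.mul' k _ ((antipodeLin k).lTensor _ s) := by
      intro s t ht
      induction s using TensorProduct.induction_on with
      | zero => simp
      | add s₁ s₂ h₁ h₂ => rw [add_mul, map_add, map_add, h₁, h₂, map_add, map_add, smul_add]
      | tmul c d =>
        have : LinearMap.mul' k _ ((antipodeLin k).lTensor _ (c ⊗ₜ[k] d * t)) =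
            c * LinearMap.mul' k _ ((antipodeLin k).lTensor _ t) * antipodeLin k d := by
          clear ht
          induction t using TensorProduct.induction_on with
          | zero => simp
          | add t₁ t₂ h₁ h₂ =>
            rw [mul_add, map_add, map_add, h₁, h₂, map_add, map_add, mul_add, add_mul]
          | tmul a b => simp [antipodeLin_mul, mul_assoc]
        rw [this, ht]
        simp [Algebra.algebraMap_eq_smul_one]
    rw [Bialgebra.comul_mul, key _ _ hy, hx, Bialgebra.counit_mul, map_mul, Algebra.smul_def,
      Algebra.commutes]

noncomputable instance : HopfAlgebra k (QuantumPerm k n) where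
  antipode := antipodeLin k
  mul_antipode_rTensor_comul := LinearMap.ext (antipode_left k)
  mul_antipode_lTensor_comul := LinearMap.ext (antipode_right k)

end QuantumPerm

/-- A Hopf algebra is a quantum permutation algebra if it is a Hopf quotient of some `A_s(N)`.
A bialgebra map between Hopf algebras automatically preserves the antipode. -/
def IsQuantumPermutationAlgebra (H : Type*) [Ring H] [HopfAlgebra k H] : Prop :=
  ∃ (N : ℕ) (f : QuantumPerm k N →ₐc[k] H), Function.Surjective f

end Wang

/-! ### Matched pairs and exact factorizations -/

/-- A matched pair of groups `(F, Γ)`: a left action `▷` of `Γ` on the set `F` and a right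
action `◁` of `F` on the set `Γ`, with the two compatibility conditions. -/
structure MatchedPair (F Γ : Type*) [Group F] [Group Γ] where
  /-- `lact g x = g ▷ x` -/
  lact : Γ → F → F
  /-- `ract g x = g ◁ x` -/
  ract : Γ → F → Γ
  one_lact : ∀ x, lact 1 x = x
  mul_lact : ∀ s t x, lact (s * t) x = lact s (lact t x)
  ract_one : ∀ s, ract s 1 = s
  ract_mul : ∀ s x y, ract s (x * y) = ract (ract s x) y
  lact_mul : ∀ s x y, lact s (x * y) = lact s x * lact (ract s x) y
  mul_ract : ∀ s t x, ract (s * t) x = ract s (lact t x) * ract t x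

namespace MatchedPair

/-- The matched pair of an exact factorization `G = F Γ`, determined by
`g x = (g ▷ x) (g ◁ x)` for `g ∈ Γ`, `x ∈ F`. -/
noncomputable def ofFactorization {G : Type*} [Group G] (F Γ : Subgroup G)
    (h : Subgroup.IsComplement' F Γ) : MatchedPair F Γ :=
  have key : ∀ (x x' : F) (g g' : Γ), (x : G) * g = x' * g' → x = x' ∧ g = g' := by
    intro x x' g g' e
    have := h.1 (a₁ := (x, g)) (a₂ := (x', g')) e
    exact ⟨congrArg Prod.fst this, congrArg Prod.snd this⟩
  have dec : ∀ (g : Γ) (x : F), ((h.equiv ((g : G) * x)).1 : G) * (h.equiv ((g : G) * x)).2 =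
      g * x := fun g x => h.equiv_fst_mul_equiv_snd _
  { lact := fun g x => (h.equiv ((g : G) * x)).1
    ract := fun g x => (h.equiv ((g : G) * x)).2
    one_lact := fun x => (key _ x _ 1 ((dec 1 x).trans (by simp))).1
    ract_one := fun s => (key _ 1 _ s ((dec s 1).trans (by simp))).2
    mul_lact := fun s t x => (key _ _ _ ((h.equiv ((s : G) * (h.equiv ((t : G) * x)).1)).2 *
      (h.equiv ((t : G) * x)).2) (by
        rw [dec, Subgroup.coe_mul, Subgroup.coe_mul, ← mul_assoc, dec, mul_assoc, mul_assoc,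
          dec])).1
    mul_ract := fun s t x => (key _ (h.equiv ((s : G) * (h.equiv ((t : G) * x)).1)).1 _ _ (by
        rw [dec, Subgroup.coe_mul, Subgroup.coe_mul, ← mul_assoc, dec, mul_assoc, mul_assoc,
          dec])).2
    lact_mul := fun s x y => (key _ _ _
      (h.equiv (((h.equiv ((s : G) * x)).2 : G) * y)).2 (by
        rw [dec, Subgroup.coe_mul, Subgroup.coe_mul, mul_assoc, dec, ← mul_assoc,
          ← mul_assoc, dec])).1
    ract_mul := fun s x y => (key _ ((h.equiv ((s : G) * x)).1 *
      (h.equiv (((h.equiv ((s : G) * x)).2 : G) * y)).1) _ _ (by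
        rw [dec, Subgroup.coe_mul, Subgroup.coe_mul, mul_assoc, dec, ← mul_assoc,
          ← mul_assoc, dec])).2 }

/-- The defining relation `g x = (g ▷ x) (g ◁ x)`. -/
theorem ofFactorization_spec {G : Type*} [Group G] (F Γ : Subgroup G)
    (h : Subgroup.IsComplement' F Γ) (g : Γ) (x : F) :
    ((ofFactorization F Γ h).lact g x : G) * (ofFactorization F Γ h).ract g x = g * x :=
  h.equiv_fst_mul_equiv_snd _

variable {F Γ : Type*} [Group F] [Group Γ] (M : MatchedPair F Γ)

theorem lact_one (s : Γ) : M.lact s 1 = 1 := by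
  have := M.lact_mul s 1 1
  rw [mul_one, M.ract_one] at this
  simpa using this

theorem one_ract (x : F) : M.ract 1 x = 1 := by
  have := M.mul_ract 1 1 x
  rw [mul_one, M.one_lact] at this
  simpa using this

theorem inv_lact (s : Γ) (x : F) : (M.lact s x)⁻¹ = M.lact (M.ract s x) x⁻¹ := by
  rw [inv_eq_iff_mul_eq_one, ← M.lact_mul, mul_inv_cancel, M.lact_one]

theorem inv_ract (s : Γ) (x : F) : (M.ract s x)⁻¹ = M.ract s⁻¹ (M.lact s x) := by
  refine inv_eq_of_mul_eq_one_left ?_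
  rw [← M.mul_ract, inv_mul_cancel, M.one_ract]

theorem ract_inv_cancel (s : Γ) (x : F) : M.ract (M.ract s x) x⁻¹ = s := by
  rw [← M.ract_mul, mul_inv_cancel, M.ract_one]

theorem ract_inv_cancel' (s : Γ) (x : F) : M.ract (M.ract s x⁻¹) x = s := by
  rw [← M.ract_mul, inv_mul_cancel, M.ract_one]

theorem ract_eq_iff (s t : Γ) (x : F) : M.ract s x = t ↔ s = M.ract t x⁻¹ :=
  ⟨fun h => by rw [← h, M.ract_inv_cancel], fun h => by rw [h, M.ract_inv_cancel']⟩

end MatchedPair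

/-! ### The split abelian extension `k^Γ # kF` of a matched pair -/

/-- The vector space `k^Γ ⊗ kF`, realized as the free vector space on the basis `e_g # x`,
`(g, x) ∈ Γ × F`. -/
def SplitExtension (k : Type*) [Field k] {F Γ : Type*} [Group F] [Group Γ]
    (_M : MatchedPair F Γ) : Type _ := (Γ × F) →₀ k

namespace SplitExtension

variable (k : Type*) [Field k] {F Γ : Type*} [Group F] [Group Γ] (M : MatchedPair F Γ)

noncomputable instance : AddCommGroup (SplitExtension k M) :=
  inferInstanceAs (AddCommGroup ((Γ × F) →₀ k))

noncomputable instance : Module k (SplitExtension k M) :=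
  inferInstanceAs (Module k ((Γ × F) →₀ k))

/-- The basis `e_g # x`. -/
noncomputable def basis : Module.Basis (Γ × F) k (SplitExtension k M) :=
  Module.Basis.ofRepr (LinearEquiv.refl k ((Γ × F) →₀ k))

/-- The basis element `e_g # x`. -/
noncomputable def e (g : Γ) (x : F) : SplitExtension k M := basis k M (g, x)

variable {k M} in
theorem linearMap_ext {N : Type*} [AddCommMonoid N] [Module k N]
    {f f' : SplitExtension k M →ₗ[k] N} (h : ∀ g x, f (e k M g x) = f' (e k M g x)) : f = f' :=
  (basis k M).ext fun p => h p.1 p.2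

variable {k} in
/-- The linear map with given values on the basis `e_g # x`. -/
noncomputable def lift {N : Type*} [AddCommMonoid N] [Module k N] (φ : Γ → F → N) :
    SplitExtension k M →ₗ[k] N := (basis k M).constr ℕ fun p => φ p.1 p.2

variable {k} in
@[simp] theorem lift_e {N : Type*} [AddCommMonoid N] [Module k N] (φ : Γ → F → N) (g : Γ) (x : F) :
    lift M φ (e k M g x) = φ g x := (basis k M).constr_basis ℕ _ _

variable {k M} in
theorem e_induction {p : SplitExtension k M → Prop} (a : SplitExtension k M)
    (he : ∀ g x, p (e k M g x)) (h0 : p 0) (hadd : ∀ a b, p a → p b → p (a + b))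
    (hsmul : ∀ (r : k) a, p a → p (r • a)) : p a := by
  have ha : a ∈ Submodule.span k (Set.range (basis k M)) := by
    rw [(basis k M).span_eq]; trivial
  induction ha using Submodule.span_induction with
  | mem x hx => obtain ⟨q, rfl⟩ := hx; exact he q.1 q.2
  | zero => exact h0
  | add a b _ _ ha hb => exact hadd a b ha hb
  | smul r a _ ha => exact hsmul r a ha

section Mul

variable [DecidableEq Γ]

/-- The product `(e_g # x)(e_h # y) = δ_{g ◁ x, h} e_g # xy`. -/
noncomputable def mulLin :
    SplitExtension k M →ₗ[k] SplitExtension k M →ₗ[k] SplitExtension k M :=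
  lift M fun g x => lift M fun h y => if M.ract g x = h then e k M g (x * y) else 0

theorem mulLin_e (g h : Γ) (x y : F) :
    mulLin k M (e k M g x) (e k M h y) = if M.ract g x = h then e k M g (x * y) else 0 := by
  simp [mulLin]

theorem mulLin_assoc (a b c : SplitExtension k M) :
    mulLin k M (mulLin k M a b) c = mulLin k M a (mulLin k M b c) := by
  induction a using e_induction with
  | h0 => simp
  | hadd a a' h h' => simp [h, h']
  | hsmul r a h => simp [h]
  | he g x =>
  induction b using e_induction with
  | h0 => simp
  | hadd a a' h h' => simp [h, h']
  | hsmul r a h => simp [h]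
  | he h y =>
  induction c using e_induction with
  | h0 => simp
  | hadd a a' h h' => simp [h, h']
  | hsmul r a h => simp [h]
  | he l z =>
  rw [mulLin_e, mulLin_e]
  by_cases h1 : M.ract g x = h
  · subst h1
    rw [if_pos rfl, mulLin_e, M.ract_mul]
    split_ifs
    · rw [mulLin_e, if_pos rfl, mul_assoc]
    · simp
  · rw [if_neg h1]
    split_ifs
    · rw [mulLin_e, if_neg h1]; simp
    · simp

variable [Fintype Γ]

theorem one_mulLin (a : SplitExtension k M) : mulLin k M (∑ g, e k M g 1) a = a := by
  induction a using e_induction with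
  | h0 => simp
  | hadd a a' h h' => rw [map_add, h, h']
  | hsmul r a h => rw [map_smul, h]
  | he g x => simp [mulLin_e, M.ract_one]

theorem mulLin_one (a : SplitExtension k M) : mulLin k M a (∑ g, e k M g 1) = a := by
  induction a using e_induction with
  | h0 => simp
  | hadd a a' h h' => rw [map_add, LinearMap.add_apply, h, h']
  | hsmul r a h => rw [map_smul, LinearMap.smul_apply, h]
  | he g x => simp [mulLin_e]

noncomputable instance : Ring (SplitExtension k M) :=
  { instAddCommGroup k M with
    mul := fun a b => mulLin k M a b
    one := ∑ g, e k M g 1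
    left_distrib := fun a b c => map_add (mulLin k M a) b c
    right_distrib := fun a b c => LinearMap.congr_fun (map_add (mulLin k M) a b) c
    zero_mul := fun a => LinearMap.congr_fun (map_zero (mulLin k M)) a
    mul_zero := fun a => map_zero (mulLin k M a)
    mul_assoc := mulLin_assoc k M
    one_mul := one_mulLin k M
    mul_one := mulLin_one k M }

theorem mul_def (a b : SplitExtension k M) : a * b = mulLin k M a b := rfl

theorem one_def : (1 : SplitExtension k M) = ∑ g, e k M g 1 := rfl

theorem e_mul_e (g h : Γ) (x y : F) :
    e k M g x * e k M h y = if M.ract g x = h then e k M g (x * y) else 0 := mulLin_e k M g h x y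

noncomputable instance : Algebra k (SplitExtension k M) :=
  Algebra.ofModule
    (fun r a b => LinearMap.congr_fun (map_smul (mulLin k M) r a) b)
    (fun r a b => map_smul (mulLin k M a) r b)

end Mul

variable [DecidableEq Γ] [Fintype Γ]

/-- The comultiplication `Δ(e_g # x) = ∑_{st = g} (e_s # (t ▷ x)) ⊗ (e_t # x)`. The sum is indexed
by `t`, with `s = g t⁻¹`. -/
noncomputable def comulLin :
    SplitExtension k M →ₗ[k] SplitExtension k M ⊗[k] SplitExtension k M :=
  lift M fun g x => ∑ t, e k M (g * t⁻¹) (M.lact t x) ⊗ₜ[k] e k M t x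

/-- The counit `ε(e_g # x) = δ_{g, 1}`. -/
noncomputable def counitLin : SplitExtension k M →ₗ[k] k :=
  lift M fun g _ => if g = 1 then 1 else 0

noncomputable instance : Coalgebra k (SplitExtension k M) where
  comul := comulLin k M
  counit := counitLin k M
  coassoc := by
    refine linearMap_ext fun g x => ?_
    simp only [comulLin, LinearMap.comp_apply, lift_e, map_sum, LinearMap.rTensor_tmul,
      LinearMap.lTensor_tmul, TensorProduct.sum_tmul, TensorProduct.tmul_sum,
      LinearEquiv.coe_coe, TensorProduct.assoc_tmul, ← M.mul_lact]
    rw [Finset.sum_comm]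
    conv_rhs => rw [Finset.sum_comm]
    rw [Finset.sum_comm]
    refine Finset.sum_congr rfl fun t _ => ?_
    refine Fintype.sum_equiv (Equiv.mulRight t) _ _ fun s => ?_
    simp [mul_assoc]
  rTensor_counit_comp_comul := by
    refine linearMap_ext fun g x => ?_
    simp [comulLin, counitLin, TensorProduct.ite_tmul, mul_inv_eq_one]
  lTensor_counit_comp_comul := by
    refine linearMap_ext fun g x => ?_
    simp [comulLin, counitLin, TensorProduct.tmul_ite, M.one_lact]

theorem comul_def : Coalgebra.comul (R := k) (A := SplitExtension k M) = comulLin k M := rfl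

theorem counit_def : Coalgebra.counit (R := k) (A := SplitExtension k M) = counitLin k M := rfl

theorem comul_e (g : Γ) (x : F) : Coalgebra.comul (R := k) (e k M g x) =
    ∑ t, e k M (g * t⁻¹) (M.lact t x) ⊗ₜ[k] e k M t x := by
  rw [comul_def, comulLin, lift_e]

theorem counit_e (g : Γ) (x : F) :
    Coalgebra.counit (R := k) (e k M g x) = if g = 1 then 1 else 0 := by
  rw [counit_def, counitLin, lift_e]

theorem counit_one' : Coalgebra.counit (R := k) (1 : SplitExtension k M) = 1 := by
  simp [one_def, counit_e]

theorem comul_one' : Coalgebra.comul (R := k) (1 : SplitExtension k M) = 1 := by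
  rw [Algebra.TensorProduct.one_def, one_def]
  simp only [map_sum, comul_e, M.lact_one, TensorProduct.tmul_sum, TensorProduct.sum_tmul]
  rw [Finset.sum_comm]
  refine Finset.sum_congr rfl fun t _ => ?_
  exact Fintype.sum_equiv (Equiv.mulRight t⁻¹) _ _ fun s => rfl

theorem counit_mul' (a b : SplitExtension k M) : Coalgebra.counit (R := k) (a * b) =
    Coalgebra.counit (R := k) a * Coalgebra.counit (R := k) b := by
  induction a using e_induction with
  | h0 => simp
  | hadd a a' h h' => simp only [add_mul, map_add, h, h']
  | hsmul r a h => simp only [smul_mul_assoc, map_smul, h]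
  | he g x =>
  induction b using e_induction with
  | h0 => simp
  | hadd a a' h h' => simp only [mul_add, map_add, h, h']
  | hsmul r a h => simp only [mul_smul_comm, map_smul, h]
  | he h y =>
  rw [e_mul_e, counit_e, counit_e]
  by_cases hg : g = 1
  · subst hg
    rw [M.one_ract]
    by_cases hh : h = 1
    · subst hh; simp [counit_e]
    · simp [hh, Ne.symm hh]
  · split_ifs <;> simp [counit_e, hg]

theorem comul_mul' (a b : SplitExtension k M) : Coalgebra.comul (R := k) (a * b) =
    Coalgebra.comul (R := k) a * Coalgebra.comul (R := k) b := by
  induction a using e_induction with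
  | h0 => simp
  | hadd a a' h h' => simp only [add_mul, map_add, h, h']
  | hsmul r a h => simp only [smul_mul_assoc, map_smul, h]
  | he g x =>
  induction b using e_induction with
  | h0 => simp
  | hadd a a' h h' => simp only [mul_add, map_add, h, h']
  | hsmul r a h => simp only [mul_smul_comm, map_smul, h]
  | he h y =>
  rw [e_mul_e, comul_e, comul_e, Finset.sum_mul_sum]
  simp only [Algebra.TensorProduct.tmul_mul_tmul, e_mul_e, TensorProduct.tmul_ite,
    Finset.sum_ite_eq, Finset.mem_univ, if_true, TensorProduct.ite_tmul]
  have hcond : ∀ t, M.ract (g * t⁻¹) (M.lact t x) = h * (M.ract t x)⁻¹ ↔ M.ract g x = h := by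
    intro t
    rw [eq_mul_inv_iff_mul_eq, ← M.mul_ract, inv_mul_cancel_right]
  simp only [hcond]
  by_cases hgh : M.ract g x = h
  · simp only [hgh, if_true, comul_e, M.lact_mul]
  · simp [hgh]

noncomputable instance : Bialgebra k (SplitExtension k M) :=
  Bialgebra.mk' k _ (counit_one' k M) (counit_mul' k M _ _) (comul_one' k M) (comul_mul' k M _ _)

/-- The antipode `S(e_g # x) = e_{(g ◁ x)⁻¹} # (g ▷ x)⁻¹`. -/
noncomputable def antipodeLin : SplitExtension k M →ₗ[k] SplitExtension k M :=
  lift M fun g x => e k M (M.ract g x)⁻¹ (M.lact g x)⁻¹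

@[simp] theorem antipodeLin_e (g : Γ) (x : F) :
    antipodeLin k M (e k M g x) = e k M (M.ract g x)⁻¹ (M.lact g x)⁻¹ := lift_e _ _ _ _

noncomputable instance : HopfAlgebra k (SplitExtension k M) where
  antipode := antipodeLin k M
  mul_antipode_rTensor_comul := by
    refine linearMap_ext fun g x => ?_
    simp only [LinearMap.comp_apply, comul_e, counit_e, map_sum, LinearMap.rTensor_tmul,
      antipodeLin_e, LinearMap.mul'_apply, e_mul_e, Algebra.linearMap_apply, M.inv_ract]
    have hcond : ∀ t, M.ract (M.ract (g * t⁻¹)⁻¹ (M.lact (g * t⁻¹) (M.lact t x)))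
        (M.lact (g * t⁻¹) (M.lact t x))⁻¹ = t ↔ g = 1 := by
      intro t
      rw [M.ract_inv_cancel]
      simp
    simp only [hcond]
    by_cases hg : g = 1
    · subst hg
      simp only [if_true, map_one, one_def, one_mul, inv_inv, ← M.mul_lact, inv_mul_cancel,
        M.one_lact]
      refine Fintype.sum_bijective (fun t => M.ract t x) ⟨fun s t hst => ?_, fun t => ?_⟩ _ _
        fun t => rfl
      · rw [← M.ract_inv_cancel s x, ← M.ract_inv_cancel t x]
        exact congrArg (fun r => M.ract r x⁻¹) hst
      · exact ⟨M.ract t x⁻¹, M.ract_inv_cancel' t x⟩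
    · simp [hg]
  mul_antipode_lTensor_comul := by
    refine linearMap_ext fun g x => ?_
    simp only [LinearMap.comp_apply, comul_e, counit_e, map_sum, LinearMap.lTensor_tmul,
      antipodeLin_e, LinearMap.mul'_apply, e_mul_e, Algebra.linearMap_apply]
    have hcond : ∀ t, M.ract (g * t⁻¹) (M.lact t x) = (M.ract t x)⁻¹ ↔ M.ract g x = 1 := by
      intro t
      rw [eq_inv_iff_mul_eq_one, ← M.mul_ract, inv_mul_cancel_right]
    have h1 : M.ract g x = 1 ↔ g = 1 := by rw [M.ract_eq_iff, M.one_ract]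
    simp only [hcond, h1, mul_inv_cancel]
    by_cases hg : g = 1
    · subst hg
      simp only [one_mul, if_true, map_one, one_def]
      exact Fintype.sum_equiv (Equiv.inv Γ) _ _ fun s => rfl
    · simp [hg]

end SplitExtension

/-! ### The factorization `S_{m+1} = S_m C_{m+1}` -/

/-- The cyclic subgroup `C_{m+1} = ⟨(1 2 ... m+1)⟩` of `S_{m+1}`; `finRotate` is `i ↦ i + 1`. -/
abbrev cyclicSubgroup (m : ℕ) : Subgroup (Equiv.Perm (Fin (m + 1))) :=
  Subgroup.zpowers (finRotate (m + 1))

/-- The subgroup of `S_{m+1}` fixing the last point, a copy of `S_m`. -/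
abbrev lastStabilizer (m : ℕ) : Subgroup (Equiv.Perm (Fin (m + 1))) :=
  MulAction.stabilizer (Equiv.Perm (Fin (m + 1))) (Fin.last m)

theorem finRotate_pow_apply (m j : ℕ) (i : Fin (m + 1)) :
    (finRotate (m + 1) ^ j) i = i + Fin.ofNat (m + 1) j := by
  induction j with
  | zero => simp
  | succ j ih =>
    rw [pow_succ', Equiv.Perm.mul_apply, ih, finRotate_apply, add_assoc]
    congr 1
    ext
    simp [Fin.val_add]

theorem isComplement_cyclic (m : ℕ) :
    Subgroup.IsComplement' (lastStabilizer m) (cyclicSubgroup m) := by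
  refine (Subgroup.isComplement'_stabilizer (Fin.last m) ?_ ?_).symm
  · rintro ⟨h, hh⟩ e
    obtain ⟨j, rfl⟩ := mem_powers_iff_mem_zpowers.2 hh
    change (finRotate (m + 1) ^ j) (Fin.last m) = Fin.last m at e
    rw [finRotate_pow_apply, add_eq_left] at e
    ext i
    change (((finRotate (m + 1) ^ j) i : Fin (m + 1)) : ℕ) = i
    rw [finRotate_pow_apply, e, add_zero]
  · intro g
    refine ⟨⟨finRotate (m + 1) ^ ((Fin.last m - g (Fin.last m) : Fin (m + 1)) : ℕ),
      Subgroup.npow_mem_zpowers _ _⟩, ?_⟩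
    change (finRotate (m + 1) ^ _) (g (Fin.last m)) = Fin.last m
    rw [finRotate_pow_apply, Fin.ofNat_val_eq_self]
    abel

/-- The matched pair `(S_m, C_{m+1})` of the exact factorization `S_{m+1} = S_m C_{m+1}`. -/
noncomputable def symMatchedPair (m : ℕ) : MatchedPair (lastStabilizer m) (cyclicSubgroup m) :=
  MatchedPair.ofFactorization _ _ (isComplement_cyclic m)

/-- The split abelian extension `k^{C_{m+1}} # k S_m`. -/
abbrev SymExtension (k : Type u) [Field k] (m : ℕ) : Type u :=
  SplitExtension k (symMatchedPair m)

/-! Cosemisimplicity. As a coalgebra `k^Γ # kF` is dual to the crossed product of the functions on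
the `Γ`-set `F` with `Γ`. A character `χ` of `Γ` and a `Γ`-orbit in `F` give a matrix coalgebra
indexed by the orbit, which is simple. Since `Γ` is abelian and `k` contains the needed roots of
unity, characters span the functions on `Γ`, so these simple coalgebras span everything
(`SplitExtension.isCosemisimple`).

Obstruction. A Hopf map from `A_s(N)` makes the commutative algebra `V = k^N` a comodule algebra.
Dually, `V` is graded by `F` and acted on by `Γ`, where `g` sends degree `x` to degree `g ▷ x` and
`g (a b) = (g a) ((g ◁ x) b)` for `a` of degree `x`. Let `v ≠ 0` have degree `x`. As `V` is reduced,
`v² ≠ 0`, so `g (v²) = (g v) ((g ◁ x) v)` is nonzero. Its factors commute, so their degrees `g ▷ x`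
and `(g ◁ x) ▷ x` commute in `F` (`MatchedPair.commute_of_ne_zero`). If the Hopf map is onto, the
degrees occurring in `V` generate `F` (`IsQuantumPermutationAlgebra.closure_eq_top`).

For `S_4 = S_3 C_4` and `S_5 = S_4 C_5`, a finite check shows that the degrees allowed by this
condition are affine maps `v ↦ a v + b` modulo 4 or 5. These form a subgroup that misses the
transposition `(0 1)`, so they cannot generate `F`. -/

/-! ### Subcoalgebras and matrix coalgebras -/

section Subcoalgebra

variable {k C : Type*} [Field k] [AddCommGroup C] [Module k C] [Coalgebra k C]

/-- Subcoalgebras are stable under both actions of the dual algebra. With the right-hand version,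
this plays the role of multiplying by matrix units in the simplicity proof below. -/
theorem IsSubcoalgebra.contract_left {D : Submodule k C} (hD : IsSubcoalgebra k D)
    (φ : C →ₗ[k] k) {d : C} (hd : d ∈ D) :
    TensorProduct.lid k C (φ.rTensor C (Coalgebra.comul (R := k) d)) ∈ D := by
  obtain ⟨t, ht⟩ := hD d hd
  rw [← ht]
  clear ht
  induction t using TensorProduct.induction_on with
  | zero => simp
  | add a b ha hb =>
    simp only [map_add]
    exact D.add_mem ha hb
  | tmul a b =>
    simp only [TensorProduct.map_tmul, LinearMap.rTensor_tmul, TensorProduct.lid_tmul]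
    exact D.smul_mem _ b.2

theorem IsSubcoalgebra.contract_right {D : Submodule k C} (hD : IsSubcoalgebra k D)
    (φ : C →ₗ[k] k) {d : C} (hd : d ∈ D) :
    TensorProduct.rid k C (φ.lTensor C (Coalgebra.comul (R := k) d)) ∈ D := by
  obtain ⟨t, ht⟩ := hD d hd
  rw [← ht]
  clear ht
  induction t using TensorProduct.induction_on with
  | zero => simp
  | add a b ha hb =>
    simp only [map_add]
    exact D.add_mem ha hb
  | tmul a b =>
    simp only [TensorProduct.map_tmul, LinearMap.lTensor_tmul, TensorProduct.rid_tmul]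
    exact D.smul_mem _ a.2

/-- The span of a matrix coalgebra is a simple subcoalgebra. -/
theorem isSimpleSubcoalgebra_span_matrix {I : Type*} [Fintype I] [Nonempty I] [DecidableEq I]
    (E : I → I → C)
    (hE : ∀ i j, Coalgebra.comul (R := k) (E i j) = ∑ l, E i l ⊗ₜ[k] E l j)
    (φ : I → I → C →ₗ[k] k)
    (hφ : ∀ i j i' j', φ i j (E i' j') = if i = i' ∧ j = j' then 1 else 0) :
    IsSimpleSubcoalgebra k (Submodule.span k (Set.range fun p : I × I => E p.1 p.2)) := by
  set D := Submodule.span k (Set.range fun p : I × I => E p.1 p.2) with hD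
  have hmem : ∀ i j, E i j ∈ D := fun i j => Submodule.subset_span ⟨(i, j), rfl⟩
  refine ⟨fun d hd => ?_, ?_, fun F hF hFD => ?_⟩
  · induction hd using Submodule.span_induction with
    | mem x hx =>
      obtain ⟨p, rfl⟩ := hx
      refine ⟨∑ l, (⟨E p.1 l, hmem _ _⟩ : D) ⊗ₜ[k] (⟨E l p.2, hmem _ _⟩ : D), ?_⟩
      simp [hE]
    | zero => rw [map_zero]; exact Submodule.zero_mem _
    | add a b _ _ ha hb => rw [map_add]; exact Submodule.add_mem _ ha hb
    | smul r a _ ha => rw [map_smul]; exact Submodule.smul_mem _ _ ha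
  · intro h
    obtain ⟨i⟩ := ‹Nonempty I›
    have h0 : E i i = 0 := by simpa [h] using hmem i i
    simpa [h0] using hφ i i i i
  · refine or_iff_not_imp_left.2 fun hne => le_antisymm hFD ?_
    obtain ⟨d, hdF, hd0⟩ := F.ne_bot_iff.1 hne
    have hdD := hFD hdF
    rw [hD, Submodule.mem_span_range_iff_exists_fun] at hdD
    obtain ⟨c, hc⟩ := hdD
    obtain ⟨⟨a, b⟩, hab⟩ : ∃ p, c p ≠ 0 := by
      by_contra! h
      exact hd0 (by rw [← hc]; simp [h])
    refine Submodule.span_le.2 ?_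
    rintro _ ⟨⟨p, q⟩, rfl⟩
    -- Contracting on the left moves row `a` to row `p`, and on the right column `b` to column `q`;
    -- all other terms of `d` die, leaving `c (a, b) • E p q`.
    have key := hF.contract_right (φ q b) (hF.contract_left (φ a p) hdF)
    have : TensorProduct.rid k C ((φ q b).lTensor C (Coalgebra.comul (R := k)
        (TensorProduct.lid k C ((φ a p).rTensor C (Coalgebra.comul (R := k) d))))) =
        c (a, b) • E p q := by
      rw [← hc]
      simp only [map_sum, map_smul, hE, LinearMap.rTensor_tmul, LinearMap.lTensor_tmul,
        TensorProduct.lid_tmul, TensorProduct.rid_tmul, hφ, Fintype.sum_prod_type, ite_and,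
        ite_smul, one_smul, zero_smul, smul_ite, smul_zero, Finset.smul_sum,
        Finset.sum_ite_eq, Finset.mem_univ, if_true, Finset.sum_ite_irrel, Finset.sum_const_zero]
    rw [this] at key
    exact (F.smul_mem_iff hab).1 key

end Subcoalgebra

/-! ### Characters of a finite abelian group -/

/-- Over a field with enough roots of unity, the characters of a finite abelian group span
the functions on it. -/
theorem span_monoidHom_eq_top {k G : Type*} [Field k] [CommGroup G] [Finite G]
    [HasEnoughRootsOfUnity k (Monoid.exponent G)] :
    Submodule.span k (Set.range fun χ : G →* k => (χ : G → k)) = ⊤ := by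
  classical
  have := Fintype.ofFinite G
  let e : (G →* kˣ) → (G →* k) := fun χ => (Units.coeHom k).comp χ
  have he : Function.Injective e := fun χ ψ h => by
    ext g
    exact DFunLike.congr_fun h g
  -- Dedekind independence, combined with the existence of `|G|` characters, gives a basis of the
  -- functions.
  have hli : LinearIndependent k fun χ : G →* kˣ => (e χ : G → k) :=
    (linearIndependent_monoidHom G k).comp e he
  have := Fintype.ofFinite (G →* kˣ)
  have hcard : Fintype.card (G →* kˣ) = Module.finrank k (G → k) := by
    rw [Module.finrank_fintype_fun_eq_card, ← Nat.card_eq_fintype_card, ← Nat.card_eq_fintype_card]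
    exact CommGroup.card_monoidHom_of_hasEnoughRootsOfUnity G k
  have htop := hli.span_eq_top_of_card_eq_finrank' hcard
  refine eq_top_iff.2 (htop ▸ Submodule.span_mono ?_)
  rintro _ ⟨χ, rfl⟩
  exact ⟨e χ, rfl⟩

/-! ### Cosemisimplicity of split extensions -/

namespace SplitExtension

variable (k : Type*) [Field k] {F Γ : Type*} [Group F] [Group Γ] (M : MatchedPair F Γ)
variable [DecidableEq Γ] [Fintype Γ]

open Classical in
/-- The matrix coefficient `∑_{g ▷ x = y} χ(g) e_g # x`. -/
noncomputable def matCoeff (χ : Γ →* k) (y x : F) : SplitExtension k M :=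
  ∑ g, if M.lact g x = y then χ g • e k M g x else 0

-- Multiplicativity of `χ` and `(s t) ▷ x = s ▷ (t ▷ x)` split each term, with `z = t ▷ x` as the
-- intermediate index. `I` may be any `Γ`-stable set containing `x`; it is applied to an orbit.
open Classical in
theorem comul_matCoeff (χ : Γ →* k) (I : Set F) [Fintype I] (hI : ∀ g, ∀ x ∈ I, M.lact g x ∈ I)
    (y x : F) (hx : x ∈ I) : Coalgebra.comul (R := k) (matCoeff k M χ y x) =
      ∑ z : I, matCoeff k M χ y z ⊗ₜ[k] matCoeff k M χ z x := by
  have h1 : ∀ z : I, matCoeff k M χ y z ⊗ₜ[k] matCoeff k M χ z x = ∑ t, ∑ s,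
      if (⟨M.lact t x, hI t x hx⟩ : I) = z then
        (if M.lact s z = y then (χ s * χ t) • (e k M s z ⊗ₜ[k] e k M t x) else 0) else 0 := by
    intro z
    rw [matCoeff, matCoeff, TensorProduct.tmul_sum]
    refine Finset.sum_congr rfl fun t _ => ?_
    rw [TensorProduct.sum_tmul]
    refine Finset.sum_congr rfl fun s _ => ?_
    by_cases h : M.lact t x = z
    · rw [if_pos h, if_pos (Subtype.ext h)]
      split_ifs
      · rw [TensorProduct.smul_tmul_smul]
      · rw [TensorProduct.zero_tmul]
    · rw [if_neg h, if_neg (fun h' => h (congrArg Subtype.val h')), TensorProduct.tmul_zero]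
  simp only [h1]
  rw [Finset.sum_comm]
  simp only [Finset.sum_comm (s := (Finset.univ : Finset I)), Finset.sum_ite_eq, Finset.mem_univ,
    if_true]
  rw [matCoeff, map_sum]
  have h2 : ∀ g, Coalgebra.comul (R := k) (if M.lact g x = y then χ g • e k M g x else 0) =
      ∑ t, if M.lact g x = y then
        χ g • (e k M (g * t⁻¹) (M.lact t x) ⊗ₜ[k] e k M t x) else 0 := by
    intro g
    split_ifs
    · rw [map_smul, comul_e, Finset.smul_sum]
    · simp
  simp only [h2]
  rw [Finset.sum_comm]
  refine Finset.sum_congr rfl fun t _ => Fintype.sum_equiv (Equiv.mulRight t⁻¹) _ _ fun g => ?_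
  simp [← M.mul_lact, ← map_mul]

theorem coord_matCoeff (χ : Γ →* k) (g : Γ) (z y x : F) [Decidable (M.lact g z = y ∧ z = x)] :
    (basis k M).coord (g, z) (matCoeff k M χ y x) =
      if M.lact g z = y ∧ z = x then χ g else 0 := by
  classical
  simp only [matCoeff, e, map_sum, apply_ite ((basis k M).coord (g, z)), map_smul, map_zero,
    Module.Basis.coord_apply, Module.Basis.repr_self, Finsupp.single_apply, Prod.mk.injEq]
  rw [Finset.sum_eq_single g]
  · by_cases h : x = z
    · subst h; simp
    · simp [h, Ne.symm h]
  · intro h _ hh; simp [hh]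
  · simp

/-- The split abelian extension is cosemisimple as soon as the characters of `Γ` span the
functions on `Γ`. -/
theorem isCosemisimple
    (hchar : Submodule.span k (Set.range fun χ : Γ →* k => (χ : Γ → k)) = ⊤) :
    IsCosemisimple k (SplitExtension k M) := by
  classical
  rw [IsCosemisimple, eq_top_iff]
  set T := sSup {D : Submodule k (SplitExtension k M) | IsSimpleSubcoalgebra k D} with hT
  have hcoef : ∀ (χ : Γ →* k) (t : Γ) (x : F), matCoeff k M χ (M.lact t x) x ∈ T := by
    intro χ t x
    let I : Set F := Set.range fun g => M.lact g x
    have hx : x ∈ I := ⟨1, M.one_lact x⟩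
    have hI : ∀ g, ∀ z ∈ I, M.lact g z ∈ I := by
      rintro g _ ⟨h, rfl⟩
      exact ⟨g * h, M.mul_lact g h x⟩
    have : Nonempty I := ⟨⟨x, hx⟩⟩
    have htrans : ∀ y z : I, ∃ g, M.lact g z = y := by
      rintro ⟨_, g, rfl⟩ ⟨_, h, rfl⟩
      exact ⟨g * h⁻¹, by simp [← M.mul_lact]⟩
    -- `r y z` carries `z` to `y`. The coordinate at `(r y z, z)`, rescaled by `χ (r y z)⁻¹`, is
    -- then dual to the matrix coefficient `(y, z)`.
    choose r hr using htrans
    have hχ : ∀ g, χ g ≠ 0 := fun g h => by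
      have : χ (g * g⁻¹) = 0 := by rw [map_mul, h, zero_mul]
      simp at this
    have hs := isSimpleSubcoalgebra_span_matrix (k := k)
      (fun y z : I => matCoeff k M χ y z)
      (fun y z => comul_matCoeff k M χ I hI y z z.2)
      (fun y z => (χ (r y z))⁻¹ • (basis k M).coord (r y z, (z : F)))
      (fun y z y' z' => by
        rw [LinearMap.smul_apply, coord_matCoeff, hr]
        simp only [Subtype.ext_iff, smul_eq_mul, mul_ite, mul_zero, inv_mul_cancel₀ (hχ _)])
    exact (le_sSup hs : _ ≤ T)
      (Submodule.subset_span ⟨(⟨M.lact t x, t, rfl⟩, ⟨x, hx⟩), rfl⟩)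
  have hsum : ∀ (χ : Γ →* k) (x : F), ∑ g, χ g • e k M g x ∈ T := by
    intro χ x
    -- Grouping the `g` by the value of `g ▷ x` turns the sum into a column of matrix coefficients.
    have : ∑ g, χ g • e k M g x =
        ∑ y ∈ Finset.univ.image fun t => M.lact t x, matCoeff k M χ y x := by
      simp only [matCoeff]
      rw [Finset.sum_comm]
      simp
    rw [this]
    refine Submodule.sum_mem _ fun y hy => ?_
    obtain ⟨t, -, rfl⟩ := Finset.mem_image.1 hy
    exact hcoef χ t x
  have hfun : ∀ (c : Γ → k) (x : F), ∑ g, c g • e k M g x ∈ T := by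
    intro c x
    have hc : c ∈ Submodule.span k (Set.range fun χ : Γ →* k => (χ : Γ → k)) := by
      rw [hchar]; trivial
    induction hc using Submodule.span_induction with
    | mem c hc => obtain ⟨χ, rfl⟩ := hc; exact hsum χ x
    | zero => simp
    | add a b _ _ ha hb =>
      simp only [Pi.add_apply, add_smul, Finset.sum_add_distrib]
      exact T.add_mem ha hb
    | smul r a _ ha =>
      simp only [Pi.smul_apply, smul_eq_mul, mul_smul, ← Finset.smul_sum]
      exact T.smul_mem r ha
  intro a _
  induction a using e_induction with
  | h0 => exact T.zero_mem
  | hadd a b ha hb => exact T.add_mem (ha trivial) (hb trivial)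
  | hsmul r a ha => exact T.smul_mem r (ha trivial)
  | he g x => simpa [Pi.single_apply] using hfun (Pi.single g 1) x

end SplitExtension

/-! ### The dual Hopf algebra in coordinates -/

namespace SplitExtension

variable (k : Type*) [Field k] {F Γ : Type*} [Group F] [Group Γ] (M : MatchedPair F Γ)
variable [DecidableEq Γ]

open Classical in
theorem coord_e (g h : Γ) (x y : F) :
    (basis k M).coord (g, x) (e k M h y) = if h = g ∧ y = x then 1 else 0 := by
  simp [e, Finsupp.single_apply]

variable [Fintype Γ]

/-- This is the coproduct of the dual basis; it becomes the twisted product rule `g (a b) = (g a)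
((g ◁ x) b)` on comodule algebras. -/
theorem coord_mul [Fintype F] (g : Γ) (z : F) (a b : SplitExtension k M) :
    (basis k M).coord (g, z) (a * b) =
      ∑ x, (basis k M).coord (g, x) a * (basis k M).coord (M.ract g x, x⁻¹ * z) b := by
  classical
  induction a using e_induction with
  | h0 => simp
  | hadd a a' h h' => simp only [add_mul, map_add, h, h', Finset.sum_add_distrib]
  | hsmul r a h => simp only [smul_mul_assoc, map_smul, h, smul_eq_mul, mul_assoc, Finset.mul_sum]
  | he s x =>
  induction b using e_induction with
  | h0 => simp
  | hadd a a' h h' => simp only [mul_add, map_add, h, h', Finset.sum_add_distrib]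
  | hsmul r a h =>
    simp only [mul_smul_comm, map_smul, h, smul_eq_mul, mul_left_comm _ r, Finset.mul_sum]
  | he t y =>
  simp only [e_mul_e, coord_e, apply_ite ((basis k M).coord (g, z)), map_zero]
  rw [Finset.sum_eq_single x]
  · by_cases hs : s = g
    · subst hs
      simp [eq_inv_mul_iff_mul_eq, ← ite_and, eq_comm]
    · simp [hs]
  · intro x' _ hx'
    simp [Ne.symm hx']
  · simp

-- This is the product of the dual basis: the functional at `(t, x)` behaves as the projection onto
-- degree `x` followed by `t`, and so lands in degree `t ▷ x`.
open Classical in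
theorem coord_tensor_comul (s t : Γ) (y x : F) (a : SplitExtension k M) :
    LinearMap.mul' k k (TensorProduct.map ((basis k M).coord (s, y)) ((basis k M).coord (t, x))
      (Coalgebra.comul (R := k) a)) =
      if y = M.lact t x then (basis k M).coord (s * t, x) a else 0 := by
  induction a using e_induction with
  | h0 => simp
  | hadd a a' h h' => simp only [map_add, h, h']; split_ifs <;> simp
  | hsmul r a h => simp only [map_smul, h]; split_ifs <;> simp
  | he g z =>
  simp only [comul_e, map_sum, TensorProduct.map_tmul, LinearMap.mul'_apply, coord_e]
  rw [Finset.sum_eq_single t]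
  · by_cases hz : z = x
    · subst hz
      simp only [mul_inv_eq_iff_eq_mul, eq_comm (a := y)]
      simp [← ite_and, and_comm]
    · simp [hz]
  · intro t' _ ht'
    simp [ht']
  · simp

/-- The elements of `k^Γ # kF` supported on a subgroup of `F` form a subalgebra. -/
noncomputable def supportedOn [Fintype F] (K : Subgroup F) :
    Subalgebra k (SplitExtension k M) where
  carrier := {a | ∀ g x, x ∉ K → (basis k M).coord (g, x) a = 0}
  zero_mem' := by intro g x _; simp
  add_mem' := by
    intro a b ha hb g x hx
    rw [map_add, ha g x hx, hb g x hx, add_zero]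
  mul_mem' := by
    intro a b ha hb g z hz
    rw [coord_mul]
    refine Finset.sum_eq_zero fun x _ => ?_
    by_cases hx : x ∈ K
    · rw [hb _ _ fun h => hz (by simpa using K.mul_mem hx h), mul_zero]
    · rw [ha _ _ hx, zero_mul]
  algebraMap_mem' := by
    intro r g x hx
    have hx1 : (1 : F) ≠ x := fun h => hx (h ▸ K.one_mem)
    classical
    simp only [Algebra.algebraMap_eq_smul_one, one_def, map_smul, map_sum, coord_e]
    simp [hx1]

end SplitExtension

/-! ### The commutation obstruction -/

namespace MatchedPair

variable {F Γ : Type*} [Group F] [Group Γ] (M : MatchedPair F Γ)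

/-- Let `F` grade and `Γ` act on a reduced commutative ring `V` compatibly with the matched pair,
where `A g x` is the projection onto degree `x` followed by `g`. If the component of degree `x` is
nonzero, then `g ▷ x` and `(g ◁ x) ▷ x` commute. -/
theorem commute_of_ne_zero [Fintype F] [DecidableEq F] {V : Type*} [CommRing V] [IsReduced V]
    (A : Γ → F → V →+ V)
    (hcomp : ∀ s y t x v, A s y (A t x v) = if y = M.lact t x then A (s * t) x v else 0)
    (hmul : ∀ g z a b, A g z (a * b) = ∑ x, A g x a * A (M.ract g x) (x⁻¹ * z) b)
    {x : F} (hx : A 1 x ≠ 0) (g : Γ) :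
    Commute (M.lact g x) (M.lact (M.ract g x) x) := by
  -- When the left factor is homogeneous, of degree `t ▷ w`, only one term of the product rule
  -- survives.
  have homog : ∀ s t z w a b, A s z (A t w a * b) =
      A (s * t) w a * A (M.ract s (M.lact t w)) ((M.lact t w)⁻¹ * z) b := by
    intro s t z w a b
    rw [hmul, Finset.sum_eq_single (M.lact t w)]
    · rw [hcomp, if_pos rfl]
    · intro y _ hy
      rw [hcomp, if_neg hy, zero_mul]
    · simp
  obtain ⟨v, hv⟩ : ∃ v, A 1 x v ≠ 0 := by
    by_contra! h
    exact hx (AddMonoidHom.ext h)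
  set b := A g x v with hb
  set b' := A (M.ract g x) x v with hb'
  have hg : A g (x * x) (A 1 x v * A 1 x v) = b * b' := by
    rw [homog, M.one_lact, mul_one, inv_mul_cancel_left, hcomp, M.one_lact, if_pos rfl, mul_one]
  -- `g⁻¹` takes `b * b'` back to the square of `A 1 x v`, which is nonzero because `V` is reduced.
  have hne : b * b' ≠ 0 := by
    intro h0
    have h1 := hcomp g⁻¹ (M.lact g (x * x)) g (x * x) (A 1 x v * A 1 x v)
    rw [hg, h0, map_zero, if_pos rfl, inv_mul_cancel, homog, M.one_lact, one_mul, M.one_ract,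
      inv_mul_cancel_left, hcomp, M.one_lact, if_pos rfl, one_mul] at h1
    exact hv (eq_zero_of_pow_eq_zero ((sq _).trans h1.symm))
  -- The same projection is computed on `b * b'` and on `b' * b`: it fixes the first, and kills the
  -- second unless the two degrees commute.
  have h1 : A 1 (M.lact g x * M.lact (M.ract g x) x) (b * b') = b * b' := by
    rw [hb, hb', homog, inv_mul_cancel_left, M.one_ract, hcomp, if_pos rfl, one_mul, one_mul]
  have h2 : A 1 (M.lact g x * M.lact (M.ract g x) x) (b' * b) =
      b' * if M.lact g x * M.lact (M.ract g x) x = M.lact (M.ract g x) x * M.lact g x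
        then b else 0 := by
    rw [hb, hb', homog, M.one_ract, hcomp, one_mul, one_mul]
    simp only [inv_mul_eq_iff_eq_mul]
  by_contra hc
  rw [if_neg (id hc : ¬_ = _), mul_zero, mul_comm, h1] at h2
  exact hne h2

end MatchedPair

/-- If the split abelian extension of a matched pair is a quantum permutation algebra, then `F` is
generated by elements all of whose translates `y` satisfy that `g ▷ y` and `(g ◁ y) ▷ y` commute
for all `g`. -/
theorem IsQuantumPermutationAlgebra.closure_eq_top {k : Type u} [Field k] {F Γ : Type*} [Group F]
    [Group Γ] [Finite F] [DecidableEq Γ] [Fintype Γ] {M : MatchedPair F Γ}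
    (H : IsQuantumPermutationAlgebra k (SplitExtension k M)) :
    Subgroup.closure {x | ∀ h g, Commute (M.lact g (M.lact h x))
      (M.lact (M.ract g (M.lact h x)) (M.lact h x))} = ⊤ := by
  classical
  have := Fintype.ofFinite F
  obtain ⟨N, f, hf⟩ := H
  -- `k^N` coacts by `δ_j ↦ ∑ i, δ_i ⊗ f (u i j)`; `c g x` is the action of the dual basis vector at
  -- `(g, x)`.
  let c (g : Γ) (x : F) : Matrix (Fin N) (Fin N) k := Matrix.of fun i j =>
    (SplitExtension.basis k M).coord (g, x) (f (QuantumPerm.u k i j))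
  let A (g : Γ) (x : F) : (Fin N → k) →+ (Fin N → k) := (c g x).mulVecLin.toAddMonoidHom
  have hAapp : ∀ g x v, A g x v = (c g x).mulVec v := fun _ _ _ => rfl
  have hA0 : ∀ g x, A g x = 0 → c g x = 0 := by
    intro g x h
    ext i j
    have := congrFun (DFunLike.congr_fun h (Pi.single j 1)) i
    simpa [hAapp] using this
  have hc : ∀ s y t x, c s y * c t x = if y = M.lact t x then c (s * t) x else 0 := by
    intro s y t x
    ext i j
    have h1 := SplitExtension.coord_tensor_comul k M s t y x (f (QuantumPerm.u k i j))
    rw [← CoalgHomClass.map_comp_comul_apply, QuantumPerm.comul_u] at h1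
    simp only [map_sum, TensorProduct.map_tmul, LinearMap.mul'_apply] at h1
    refine h1.trans ?_
    split_ifs <;> rfl
  have hcomp : ∀ s y t x v, A s y (A t x v) = if y = M.lact t x then A (s * t) x v else 0 := by
    intro s y t x v
    rw [hAapp, hAapp, Matrix.mulVec_mulVec, hc]
    split_ifs
    · rfl
    · exact Matrix.zero_mulVec v
  have hmul : ∀ g z a b, A g z (a * b) = ∑ x, A g x a * A (M.ract g x) (x⁻¹ * z) b := by
    intro g z a b
    ext i
    -- The row relation `u i j * u i l = δ_{jl} u i j` says that the coaction respects the pointwise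
    -- product.
    have h1 : ∀ j l, ∑ x, c g x i j * c (M.ract g x) (x⁻¹ * z) i l =
        if j = l then c g z i j else 0 := by
      intro j l
      refine (SplitExtension.coord_mul k M g z _ _).symm.trans ?_
      rw [← map_mul, QuantumPerm.u_row_mul]
      split_ifs
      · rfl
      · rw [map_zero, map_zero]
    simp only [hAapp, Finset.sum_apply, Pi.mul_apply, Matrix.mulVec, dotProduct,
      Finset.sum_mul_sum]
    rw [Finset.sum_comm]
    refine Finset.sum_congr rfl fun j _ => ?_
    rw [Finset.sum_comm]
    have h2 : ∀ l, ∑ x, c g x i j * a j * (c (M.ract g x) (x⁻¹ * z) i l * b l) =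
        (if j = l then c g z i j else 0) * (a j * b l) := by
      intro l
      rw [← h1, Finset.sum_mul]
      exact Finset.sum_congr rfl fun x _ => by ring
    simp [h2]
  set T := {x | ∀ h g, Commute (M.lact g (M.lact h x))
      (M.lact (M.ract g (M.lact h x)) (M.lact h x))} with hT
  have hmem : ∀ g x, c g x ≠ 0 → x ∈ T := by
    intro g x hgx h g'
    refine M.commute_of_ne_zero A hcomp hmul (fun h0 => hgx ?_) g'
    -- `c g x` factors through `c h x`, which in turn factors through `c 1 (h ▷ x)`. Hence a nonzero
    -- `c g x` makes every degree `h ▷ x` occur.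
    have h1 := hc (g * h⁻¹) (M.lact h x) h x
    rw [if_pos rfl, inv_mul_cancel_right] at h1
    have h2 := hc 1 (M.lact h x) h x
    rw [if_pos rfl, one_mul, hA0 _ _ h0, zero_mul] at h2
    rw [← h1, ← h2, mul_zero]
  refine eq_top_iff.2 fun x _ => ?_
  have hrange : ∀ a, f a ∈ SplitExtension.supportedOn k M (Subgroup.closure T) := by
    intro a
    have ha : a ∈ Algebra.adjoin k {a | ∃ i j, a = QuantumPerm.u k (n := N) i j} := by
      rw [QuantumPerm.adjoin_u]; trivial
    induction ha using Algebra.adjoin_induction with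
    | mem x hx =>
      obtain ⟨i, j, rfl⟩ := hx
      intro g x hx
      by_contra h
      exact hx (Subgroup.subset_closure (hmem g x fun h0 => h (congrFun (congrFun h0 i) j)))
    | algebraMap r => rw [AlgHomClass.commutes]; exact Subalgebra.algebraMap_mem _ r
    | add a b _ _ ha hb => rw [map_add]; exact Subalgebra.add_mem _ ha hb
    | mul a b _ _ ha hb => rw [map_mul]; exact Subalgebra.mul_mem _ ha hb
  by_contra hx
  obtain ⟨a, ha⟩ := hf (SplitExtension.e k M 1 x)
  have := hrange a 1 x hx
  rw [ha, SplitExtension.coord_e] at this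
  simp at this

/-! ### The factorization by rotations and affine permutations -/

/-- For `c = finRotate (n + 1)`, the exponent `j` such that `c ^ i * y * c ^ (-j)` fixes the last
point. -/
def rotExp {n : ℕ} (i : Fin (n + 1)) (y : Equiv.Perm (Fin (n + 1))) : Fin (n + 1) :=
  Fin.last n - y.symm (Fin.last n - i)

/-- The permutation `c ^ i * y * c ^ (-j)` fixing the last point, where `c = finRotate (n + 1)`. -/
def rotPerm {n : ℕ} (i : Fin (n + 1)) (y : Equiv.Perm (Fin (n + 1))) :
    Equiv.Perm (Fin (n + 1)) :=
  (Equiv.subRight (rotExp i y)).trans (y.trans (Equiv.addRight i))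

/-- The element `c ^ i` of the cyclic subgroup. -/
def rot {n : ℕ} (i : Fin (n + 1)) : cyclicSubgroup n :=
  ⟨finRotate (n + 1) ^ (i : ℕ), Subgroup.npow_mem_zpowers _ _⟩

theorem rot_apply {n : ℕ} (i v : Fin (n + 1)) :
    (rot i : Equiv.Perm (Fin (n + 1))) v = v + i := by
  simp [rot, finRotate_pow_apply]

theorem rotPerm_mul_rot {n : ℕ} (i : Fin (n + 1)) (y : Equiv.Perm (Fin (n + 1))) :
    rotPerm i y * (rot (rotExp i y) : Equiv.Perm (Fin (n + 1))) = rot i * y := by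
  ext v
  simp [rot_apply, rotPerm]

theorem rotPerm_mem {n : ℕ} (i : Fin (n + 1)) (y : Equiv.Perm (Fin (n + 1))) :
    rotPerm i y ∈ lastStabilizer n := by
  rw [MulAction.mem_stabilizer_iff, Equiv.Perm.smul_def]
  simp [rotPerm, rotExp]

/-- Uniqueness of the exact factorization identifies the abstract actions with explicit formulas, on
which `decide` can compute. -/
theorem symMatchedPair_rot {n : ℕ} (i : Fin (n + 1)) (y : lastStabilizer n) :
    (symMatchedPair n).lact (rot i) y = ⟨rotPerm i y, rotPerm_mem i y⟩ ∧
      (symMatchedPair n).ract (rot i) y = rot (rotExp i (y : Equiv.Perm (Fin (n + 1)))) := by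
  have h := (isComplement_cyclic n).1
    (a₁ := ((symMatchedPair n).lact (rot i) y, (symMatchedPair n).ract (rot i) y))
    (a₂ := (⟨rotPerm i y, rotPerm_mem i y⟩, rot (rotExp i (y : Equiv.Perm (Fin (n + 1))))))
    ((MatchedPair.ofFactorization_spec _ _ _ (rot i) y).trans (rotPerm_mul_rot i y).symm)
  exact ⟨congrArg Prod.fst h, congrArg Prod.snd h⟩

/-- A finite check of a weakening of the commutation condition: only `g = c` is used, and the two
products are compared only at the point `0`. This already forces affinity. -/
theorem affine_of_rotPerm_comm_three :
    ∀ x : Equiv.Perm (Fin 4), x (Fin.last 3) = Fin.last 3 →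
    (∀ h, rotPerm 1 (rotPerm h x) (rotPerm (rotExp 1 (rotPerm h x)) (rotPerm h x) 0) =
      rotPerm (rotExp 1 (rotPerm h x)) (rotPerm h x) (rotPerm 1 (rotPerm h x) 0)) →
    ∃ a, ∀ i v, x (i + v) = x i + a * v := by
  decide +kernel

theorem affine_of_rotPerm_comm_four :
    ∀ x : Equiv.Perm (Fin 5), x (Fin.last 4) = Fin.last 4 →
    (∀ h, rotPerm 1 (rotPerm h x) (rotPerm (rotExp 1 (rotPerm h x)) (rotPerm h x) 0) =
      rotPerm (rotExp 1 (rotPerm h x)) (rotPerm h x) (rotPerm 1 (rotPerm h x) 0)) →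
    ∃ a, ∀ i v, x (i + v) = x i + a * v := by
  decide +kernel

open scoped Fin.CommRing in
/-- The affine permutations of `Fin (n + 1)`. -/
def affinePerm (n : ℕ) : Subgroup (Equiv.Perm (Fin (n + 1))) where
  carrier := {x | ∃ a, ∀ i v, x (i + v) = x i + a * v}
  one_mem' := ⟨1, by simp⟩
  mul_mem' := by
    rintro x y ⟨a, ha⟩ ⟨b, hb⟩
    exact ⟨a * b, fun i v => by simp only [Equiv.Perm.mul_apply, hb, ha, mul_assoc]⟩
  inv_mem' := by
    rintro x ⟨a, ha⟩
    -- Bijectivity of `x` makes the slope `a` invertible: `x b - x 0 = a * b` is chosen to be `1`.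
    obtain ⟨b, hb⟩ := x.surjective (x 0 + 1)
    have hab : a * b = 1 := by
      have := ha 0 b
      rw [zero_add, hb] at this
      exact (add_left_cancel this).symm
    refine ⟨b, fun i v => ?_⟩
    rw [Equiv.Perm.inv_eq_iff_eq, ha, ← mul_assoc, hab, one_mul]
    simp

theorem swap_notMem_affinePerm_three : Equiv.swap (0 : Fin 4) 1 ∉ affinePerm 3 := by
  change ¬ ∃ a, ∀ i v : Fin 4, Equiv.swap (0 : Fin 4) 1 (i + v) = Equiv.swap (0 : Fin 4) 1 i + a * v
  decide +kernel

theorem swap_notMem_affinePerm_four : Equiv.swap (0 : Fin 5) 1 ∉ affinePerm 4 := by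
  change ¬ ∃ a, ∀ i v : Fin 5, Equiv.swap (0 : Fin 5) 1 (i + v) = Equiv.swap (0 : Fin 5) 1 i + a * v
  decide +kernel

/-- If every admissible degree is affine, so is everything these degrees generate; a non-affine `s`
in the point stabilizer then contradicts generation. -/
theorem not_isQuantumPermutationAlgebra_symExtension (k : Type u) [Field k] {m : ℕ}
    (h : ∀ x : Equiv.Perm (Fin (m + 1)), x (Fin.last m) = Fin.last m →
      (∀ h, rotPerm 1 (rotPerm h x) (rotPerm (rotExp 1 (rotPerm h x)) (rotPerm h x) 0) =
        rotPerm (rotExp 1 (rotPerm h x)) (rotPerm h x) (rotPerm 1 (rotPerm h x) 0)) →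
      x ∈ affinePerm m)
    {s : Equiv.Perm (Fin (m + 1))} (hs : s (Fin.last m) = Fin.last m) (hs' : s ∉ affinePerm m) :
    ¬ IsQuantumPermutationAlgebra k (SymExtension k m) := by
  intro H
  have hle : (⊤ : Subgroup (lastStabilizer m)) ≤ (affinePerm m).subgroupOf (lastStabilizer m) := by
    rw [← H.closure_eq_top, Subgroup.closure_le]
    intro x hx
    refine h x x.2 fun i => ?_
    have := hx (rot i) (rot 1)
    rw [(symMatchedPair_rot i x).1, (symMatchedPair_rot 1 _).1, (symMatchedPair_rot 1 _).2,
      (symMatchedPair_rot _ _).1] at this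
    exact Equiv.congr_fun (congrArg Subtype.val this.eq) 0
  exact hs' (hle (x := ⟨s, hs⟩) trivial)

/-! ### Dimensions and conclusion -/

theorem finrank_symExtension (k : Type u) [Field k] (m : ℕ) :
    Module.finrank k (SymExtension k m) = (m + 1).factorial := by
  rw [Module.finrank_eq_nat_card_basis (SplitExtension.basis k (symMatchedPair m)), Nat.card_prod,
    mul_comm, (isComplement_cyclic m).card_mul_card, Nat.card_perm, Nat.card_fin]

theorem isCosemisimple_symExtension (k : Type u) [Field k] [IsAlgClosed k] [CharZero k] (m : ℕ) :
    IsCosemisimple k (SymExtension k m) := by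
  refine SplitExtension.isCosemisimple k _ ?_
  -- The commutative structure extends the existing group structure, so its characters are those of
  -- the goal.
  let _ : CommGroup (cyclicSubgroup m) :=
    { (inferInstance : Group (cyclicSubgroup m)) with
      mul_comm := fun a b => mul_comm' a b }
  exact span_monoidHom_eq_top

theorem theorem7p5 (k : Type u) [Field k] [IsAlgClosed k] [CharZero k] :
    (Module.finrank k (SymExtension k 3) = 24 ∧ IsCosemisimple k (SymExtension k 3) ∧
      ¬ IsQuantumPermutationAlgebra k (SymExtension k 3)) ∧
    (Module.finrank k (SymExtension k 4) = 120 ∧ IsCosemisimple k (SymExtension k 4) ∧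
      ¬ IsQuantumPermutationAlgebra k (SymExtension k 4)) ∧
    ∃ (H : Type u) (_ : Ring H) (_ : HopfAlgebra k H),
      Module.Finite k H ∧ IsCosemisimple k H ∧ ¬ IsQuantumPermutationAlgebra k H := by
  have h3 : ¬ IsQuantumPermutationAlgebra k (SymExtension k 3) :=
    not_isQuantumPermutationAlgebra_symExtension k affine_of_rotPerm_comm_three
      (by decide) swap_notMem_affinePerm_three
  have h4 : ¬ IsQuantumPermutationAlgebra k (SymExtension k 4) :=
    not_isQuantumPermutationAlgebra_symExtension k affine_of_rotPerm_comm_four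
      (by decide) swap_notMem_affinePerm_four
  exact ⟨⟨finrank_symExtension k 3, isCosemisimple_symExtension k 3, h3⟩,
    ⟨finrank_symExtension k 4, isCosemisimple_symExtension k 4, h4⟩,
    SymExtension k 3, inferInstance, inferInstance,
    Module.Finite.of_basis (SplitExtension.basis k (symMatchedPair 3)),
    isCosemisimple_symExtension k 3, h3⟩
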